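/- For a finite graph $H$, let $\nu(H)$ be the maximum size of a set of pairwise edge-disjoint triangles of $H$, and let $\tau(H)$ be the minimum size of a set $F$ of edges of $H$ such that every triangle of $H$ contains a member of $F$. Let $G_{n,p}$ be the binomial random graph on $n$ labelled vertices, in which each of the $\binom n2$ possible edges is present independently with probability $p$. Theorem. Let $p=p(n)\in[0,1]$ be such that $d=(n-2)p^2\le 1/2$ for all sufficiently large $n$. Then with high probability $\tau(G_{n,p})\sim\nu(G_{n,p})$; that is, for every $\varepsilon>0$, $$\Pr\bigl(|\tau(G_{n,p})-\nu(G_{n,p})|\le\varepsilon\,\nu(G_{n,p})\bigr)\to 1\qquad (n\to\infty).$$ -/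

import Mathlib

open Filter Topology

namespace TriangleTuza

variable {V : Type*}

/-- The edges (unordered pairs of distinct vertices) spanned by a set `t` of vertices; when `t` is
the vertex set of a triangle, these are the three edges of the triangle. -/
def spannedEdges (t : Finset V) : Set (Sym2 V) :=
  {e | ¬ e.IsDiag ∧ ∀ v ∈ e, v ∈ t}

/-- `T` is a set of pairwise edge-disjoint triangles of `H` (a triangle is given by its vertex set,
a clique on three vertices). -/
def IsTriangleMatching (H : SimpleGraph V) (T : Finset (Finset V)) : Prop :=
  (∀ t ∈ T, H.IsNClique 3 t) ∧
    ∀ s ∈ T, ∀ t ∈ T, s ≠ t → Disjoint (spannedEdges s) (spannedEdges t)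

/-- `F` is a set of edges of `H` such that each triangle of `H` contains a member of `F`. -/
def IsTriangleCover (H : SimpleGraph V) (F : Finset (Sym2 V)) : Prop :=
  (∀ e ∈ F, e ∈ H.edgeSet) ∧
    ∀ t : Finset V, H.IsNClique 3 t → ∃ e ∈ F, e ∈ spannedEdges t

/-- `ν(H)`: the maximum size of a set of edge-disjoint triangles of the finite graph `H`. -/
noncomputable def nu [Fintype V] (H : SimpleGraph V) : ℕ :=
  sSup {k | ∃ T : Finset (Finset V), IsTriangleMatching H T ∧ T.card = k}

/-- `τ(H)`: the minimum size of a set of edges of the finite graph `H` meeting every triangle. -/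
noncomputable def tau [Fintype V] (H : SimpleGraph V) : ℕ :=
  sInf {k | ∃ F : Finset (Sym2 V), IsTriangleCover H F ∧ F.card = k}

/-- The maximum defining `ν(H)` is attained. -/
theorem nu_isGreatest [Fintype V] (H : SimpleGraph V) :
    IsGreatest {k | ∃ T : Finset (Finset V), IsTriangleMatching H T ∧ T.card = k} (nu H) := by
  have hb : BddAbove {k | ∃ T : Finset (Finset V), IsTriangleMatching H T ∧ T.card = k} := by
    refine ⟨Fintype.card (Finset V), ?_⟩
    rintro k ⟨T, -, rfl⟩
    exact Finset.card_le_univ T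
  have hne : {k | ∃ T : Finset (Finset V), IsTriangleMatching H T ∧ T.card = k}.Nonempty :=
    ⟨0, ∅, by simp [IsTriangleMatching]⟩
  exact ⟨Nat.sSup_mem hne hb, fun k hk => le_csSup hb hk⟩

/-- The minimum defining `τ(H)` is attained. -/
theorem tau_isLeast [Fintype V] (H : SimpleGraph V) :
    IsLeast {k | ∃ F : Finset (Sym2 V), IsTriangleCover H F ∧ F.card = k} (tau H) := by
  classical
  have hne : {k | ∃ F : Finset (Sym2 V), IsTriangleCover H F ∧ F.card = k}.Nonempty := by
    refine ⟨_, H.edgeFinset, ⟨fun e he => by simpa using he, fun t ht => ?_⟩, rfl⟩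
    obtain ⟨a, b, c, hab, hac, hbc, rfl⟩ := SimpleGraph.is3Clique_iff.1 ht
    exact ⟨s(a, b), by simpa using hab, by simpa using hab.ne, by simp⟩
  exact ⟨Nat.sInf_mem hne, fun k hk => Nat.sInf_le hk⟩

end TriangleTuza

/-! Peel off triangles with a vertex at which they share no edge with the others, together with all
triangles through the opposite edge: one edge covers everything removed, and one removed triangle is
edge-disjoint from everything that remains. So `τ = ν` unless the peeling gets stuck, and then a
walk of triangles, always continued at its newest vertex, has to close up at an old vertex.
Discarding every triangle that closes a walk gives `τ ≤ ν + #(closing triangles)`.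

Each step of such a walk offers two edges and at most `n - 2` new vertices and requires two more
edges in the graph; closing the walk after `k` steps offers only `O(k)` choices and requires one
more edge. If `2d < 1`, the expected number of closing triangles is therefore `O(μ p / (1 - 2d)²)`,
where `μ` is the expected number of triangles. The case `2d = 1` reduces to this one by keeping
every edge with probability `1 - δ`: the number of triangles minus `τ` is monotone in the graph, as
is `ν`, so that `τ - ν` drops by at most `3δμ` in expectation. As `p → 0`, this gives
`E(τ - ν) = o(μ)`.

Finally, `ν` is at least the number of triangles minus the number of pairs sharing an edge. If edges
are kept with a small constant probability and `μ` is large, the second moment method shows that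
this bound is of order `μ` with probability close to one, and the theorem follows from Markov's
inequality. When `μ` is bounded, `E(τ - ν) → 0` already forces `τ = ν` with high probability. -/

open MeasureTheory ProbabilityTheory
open scoped Finset SimpleGraph

namespace TriangleTuza

section RandomGraph

instance [Countable V] : MeasurableSingletonClass (SimpleGraph V) where
  measurableSet_singleton G := by
    rw [← SimpleGraph.measurableEmbedding_edgeSet.measurableSet_image, Set.image_singleton]
    exact measurableSet_singleton _

theorem measure_ext_of_Ici {α : Type*} [Finite α] [SemilatticeSup α] [OrderBot α]
    [MeasurableSpace α] [MeasurableSingletonClass α] {μ ν : Measure α} [IsFiniteMeasure μ]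
    (h : ∀ a, μ (Set.Ici a) = ν (Set.Ici a)) : μ = ν := by
  refine ext_of_generate_finite (Set.range Set.Ici) ?_ ?_ (by simpa using h) ?_
  · refine le_antisymm (fun s _ => ?_)
      (MeasurableSpace.generateFrom_le fun _ _ => MeasurableSet.of_discrete)
    have hIci (a : α) :
        MeasurableSet[MeasurableSpace.generateFrom (Set.range Set.Ici)] (Set.Ici a) :=
      MeasurableSpace.measurableSet_generateFrom ⟨a, rfl⟩
    have hsingleton (a : α) : {a} = Set.Ici a \ ⋃ b ∈ Set.Ioi a, Set.Ici b := by
      ext x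
      simp only [Set.mem_singleton_iff, Set.mem_sdiff, Set.mem_Ici, Set.mem_iUnion, not_exists]
      exact ⟨fun hx => ⟨hx.ge, fun b hb hbx => (hb.trans_le hbx).ne' hx⟩,
        fun ⟨hax, hx⟩ => by_contra fun hne => hx x (lt_of_le_of_ne hax (Ne.symm hne)) le_rfl⟩
    rw [← Set.biUnion_of_singleton s]
    refine .biUnion s.to_countable fun a _ => hsingleton a ▸ ?_
    exact (hIci a).diff (.biUnion (Set.to_countable _) fun b _ => hIci b)
  · rintro _ ⟨a, rfl⟩ _ ⟨b, rfl⟩ -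
    exact ⟨a ⊔ b, Set.Ici_inter_Ici.symm⟩
  · simpa using h ⊥

variable [Finite V]

theorem binomialRandom_real_Ici (p : unitInterval) (H : SimpleGraph V) :
    G(V, p).real (Set.Ici H) = (p : ℝ) ^ H.edgeSet.ncard := by
  classical
  cases nonempty_fintype V
  have hpreimage : (fun q : Sym2 V → Prop => {e | q e}) ⁻¹'
      (SimpleGraph.fromEdgeSet ⁻¹' Set.Ici H) =
      (H.edgeFinset : Set (Sym2 V)).pi fun _ => {True} := by
    ext q
    simp [Set.subset_def]
  rw [measureReal_def, SimpleGraph.binomialRandom_eq_map,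
    Measure.map_apply SimpleGraph.measurable_fromEdgeSet .of_discrete, setBernoulli_apply',
    hpreimage, Measure.infinitePi_pi _ fun _ _ => .of_discrete,
    Finset.prod_congr rfl (g := fun _ => (unitInterval.toNNReal p : ENNReal)) fun e he => ?_]
  · simp [Set.ncard_eq_toFinset_card', SimpleGraph.edgeFinset]
  · simp [SimpleGraph.not_isDiag_of_mem_edgeFinset he]

theorem map_inf_binomialRandom_prod (p q : unitInterval) :
    (G(V, p).prod G(V, q)).map (fun x => x.1 ⊓ x.2) = G(V, p * q) := by
  refine measure_ext_of_Ici fun H => ?_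
  have hpreimage : (fun x : SimpleGraph V × SimpleGraph V => x.1 ⊓ x.2) ⁻¹' Set.Ici H =
      Set.Ici H ×ˢ Set.Ici H := by
    ext x
    simp only [Set.mem_preimage, Set.mem_Ici, Set.mem_prod, le_inf_iff]
  rw [Measure.map_apply (measurable_of_finite _) .of_discrete, hpreimage,
    ← measureReal_eq_measureReal_iff, measureReal_prod_prod]
  simp [binomialRandom_real_Ici, mul_pow]

theorem integral_binomialRandom_mul (p q : unitInterval) (f : SimpleGraph V → ℝ) :
    ∫ G, f G ∂G(V, p * q) = ∫ x, f (x.1 ⊓ x.2) ∂G(V, p).prod G(V, q) := by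
  rw [← map_inf_binomialRandom_prod,
    integral_map (measurable_of_finite _).aemeasurable (.of_discrete)]

theorem integral_binomialRandom_mul_le {f : SimpleGraph V → ℝ} (hf : Monotone f)
    (p q : unitInterval) : ∫ G, f G ∂G(V, p * q) ≤ ∫ G, f G ∂G(V, q) := by
  calc ∫ G, f G ∂G(V, p * q) = ∫ x, f (x.1 ⊓ x.2) ∂G(V, p).prod G(V, q) :=
        integral_binomialRandom_mul p q f
    _ ≤ ∫ x, f x.2 ∂G(V, p).prod G(V, q) :=
        integral_mono .of_finite .of_finite fun x => hf inf_le_right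
    _ = ∫ G, f G ∂G(V, q) := by simp [integral_fun_snd]

theorem binomialRandom_real_le_mul {S : Set (SimpleGraph V)} (hS : IsLowerSet S)
    (p q : unitInterval) : G(V, q).real S ≤ G(V, p * q).real S := by
  rw [← map_inf_binomialRandom_prod, map_measureReal_apply (measurable_of_finite _) .of_discrete]
  calc G(V, q).real S = (G(V, p).prod G(V, q)).real (Set.univ ×ˢ S) := by
        simp [measureReal_prod_prod]
    _ ≤ _ := measureReal_mono fun x hx => hS inf_le_right hx.2

end RandomGraph

section SubgraphCount

variable {κ : Type*}

open scoped Classical in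
/-- The number of indices `i ∈ K` such that the graph `H i` is contained in `G`. -/
noncomputable def subgraphCount (K : Finset κ) (H : κ → SimpleGraph V) (G : SimpleGraph V) : ℕ :=
  #{i ∈ K | H i ≤ G}

theorem subgraphCount_eq_sum_indicator (K : Finset κ) (H : κ → SimpleGraph V)
    (G : SimpleGraph V) :
    (subgraphCount K H G : ℝ) = ∑ i ∈ K, (Set.Ici (H i)).indicator 1 G := by
  classical
  simp [subgraphCount, Set.indicator_apply, Finset.sum_boole]

variable [Finite V] (p : unitInterval)

theorem integral_subgraphCount (K : Finset κ) (H : κ → SimpleGraph V) :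
    ∫ G, (subgraphCount K H G : ℝ) ∂G(V, p) = ∑ i ∈ K, (p : ℝ) ^ (H i).edgeSet.ncard := by
  simp_rw [subgraphCount_eq_sum_indicator]
  rw [integral_finsetSum _ fun _ _ => .of_finite]
  exact Finset.sum_congr rfl fun i _ =>
    (integral_indicator_one .of_discrete).trans (binomialRandom_real_Ici p (H i))

theorem covariance_indicator_Ici_le (H H' : SimpleGraph V) :
    cov[(Set.Ici H).indicator (1 : SimpleGraph V → ℝ), (Set.Ici H').indicator 1; G(V, p)] ≤
      (p : ℝ) ^ (H ⊔ H').edgeSet.ncard := by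
  rw [covariance_eq_sub .of_discrete .of_discrete, ← Set.inter_indicator_one, Set.Ici_inter_Ici]
  simp only [integral_indicator_one MeasurableSet.of_discrete, binomialRandom_real_Ici]
  exact sub_le_self _ (by have := p.2.1; positivity)

theorem covariance_indicator_Ici_of_disjoint {H H' : SimpleGraph V}
    (h : Disjoint H.edgeSet H'.edgeSet) :
    cov[(Set.Ici H).indicator (1 : SimpleGraph V → ℝ), (Set.Ici H').indicator 1; G(V, p)] = 0 := by
  rw [covariance_eq_sub .of_discrete .of_discrete, ← Set.inter_indicator_one, Set.Ici_inter_Ici]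
  simp only [integral_indicator_one MeasurableSet.of_discrete, binomialRandom_real_Ici,
    SimpleGraph.edgeSet_sup, Set.ncard_union_eq h, pow_add, sub_self]

open scoped Classical in
theorem variance_subgraphCount_le (K : Finset κ) (H : κ → SimpleGraph V) :
    Var[fun G => (subgraphCount K H G : ℝ); G(V, p)] ≤
      ∑ ij ∈ K ×ˢ K with ¬ Disjoint (H ij.1).edgeSet (H ij.2).edgeSet,
        (p : ℝ) ^ (H ij.1 ⊔ H ij.2).edgeSet.ncard := by
  simp_rw [subgraphCount_eq_sum_indicator]
  rw [variance_fun_sum' fun i _ => .of_discrete, ← Finset.sum_product', Finset.sum_filter]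
  refine Finset.sum_le_sum fun ij _ => ?_
  by_cases h : Disjoint (H ij.1).edgeSet (H ij.2).edgeSet
  · simpa [h] using (covariance_indicator_Ici_of_disjoint p h).le
  · simpa [h] using covariance_indicator_Ici_le p (H ij.1) (H ij.2)

end SubgraphCount

section Triangles

variable {t t' : Finset V} {G G' : SimpleGraph V}

theorem mk_mem_spannedEdges {u v : V} : s(u, v) ∈ spannedEdges t ↔ u ≠ v ∧ u ∈ t ∧ v ∈ t := by
  simp [spannedEdges]

theorem spannedEdges_eq_image_offDiag [DecidableEq V] (t : Finset V) :
    spannedEdges t = (t.offDiag.image Sym2.mk.uncurry : Finset (Sym2 V)) := by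
  ext e
  induction e with | _ u v
  rw [mk_mem_spannedEdges]
  aesop

theorem ncard_spannedEdges (t : Finset V) : (spannedEdges t).ncard = (#t).choose 2 := by
  classical
  rw [spannedEdges_eq_image_offDiag, Set.ncard_coe_finset, Sym2.card_image_offDiag]

theorem spannedEdges_inter [DecidableEq V] (t t' : Finset V) :
    spannedEdges (t ∩ t') = spannedEdges t ∩ spannedEdges t' := by
  ext e
  simp only [spannedEdges, Set.mem_inter_iff, Set.mem_ofPred_eq, Finset.mem_inter]
  grind

theorem disjoint_spannedEdges_iff [DecidableEq V] :
    Disjoint (spannedEdges t) (spannedEdges t') ↔ #(t ∩ t') ≤ 1 := by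
  have hfinite : (spannedEdges (t ∩ t')).Finite := by
    simp [spannedEdges_eq_image_offDiag, -Finset.coe_image]
  rw [Set.disjoint_iff_inter_eq_empty, ← spannedEdges_inter, ← Set.ncard_eq_zero hfinite,
    ncard_spannedEdges, Nat.choose_eq_zero_iff, Nat.lt_succ_iff]

/-- The graph on `V` whose edges are the pairs of distinct vertices in `t`. A graph contains it
exactly when `t` is a clique. -/
def cliqueOn (t : Finset V) : SimpleGraph V :=
  .fromEdgeSet (spannedEdges t)

theorem cliqueOn_adj {u v : V} : (cliqueOn t).Adj u v ↔ u ≠ v ∧ u ∈ t ∧ v ∈ t := by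
  rw [cliqueOn, SimpleGraph.fromEdgeSet_adj, mk_mem_spannedEdges]
  tauto

theorem edgeSet_cliqueOn (t : Finset V) : (cliqueOn t).edgeSet = spannedEdges t := by
  ext e
  induction e with | _ u v
  rw [SimpleGraph.mem_edgeSet, cliqueOn_adj, mk_mem_spannedEdges]

theorem ncard_edgeSet_cliqueOn (t : Finset V) : (cliqueOn t).edgeSet.ncard = (#t).choose 2 := by
  rw [edgeSet_cliqueOn, ncard_spannedEdges]

theorem cliqueOn_le_iff : cliqueOn t ≤ G ↔ G.IsClique t :=
  ⟨fun h _ hu _ hv huv => h (cliqueOn_adj.2 ⟨huv, hu, hv⟩), fun h _ _ huv =>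
    have ⟨hne, hu, hv⟩ := cliqueOn_adj.1 huv
    h hu hv hne⟩

theorem exists_mem_spannedEdges (ht : 2 ≤ #t) : ∃ e, e ∈ spannedEdges t := by
  obtain ⟨u, hu, v, hv, huv⟩ := Finset.one_lt_card.1 ht
  exact ⟨s(u, v), mk_mem_spannedEdges.2 ⟨huv, hu, hv⟩⟩

variable [Fintype V]

open scoped Classical in
/-- The triangles of `G`, given by their vertex sets. -/
noncomputable def triangles (G : SimpleGraph V) : Finset (Finset V) :=
  {t | G.IsNClique 3 t}

theorem mem_triangles : t ∈ triangles G ↔ G.IsNClique 3 t := by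
  simp [triangles]

theorem card_triangles (G : SimpleGraph V) :
    #(triangles G) = subgraphCount (Finset.univ.powersetCard 3) cliqueOn G := by
  unfold triangles subgraphCount
  congr 1
  ext t
  simp [SimpleGraph.isNClique_iff, cliqueOn_le_iff, and_comm]

theorem triangles_mono : Monotone (triangles (V := V)) :=
  fun _ _ h _ ht => mem_triangles.2 ((mem_triangles.1 ht).mono h)

theorem card_le_nu {T : Finset (Finset V)} (hT : T ⊆ triangles G)
    (hdisj : (T : Set (Finset V)).PairwiseDisjoint spannedEdges) : #T ≤ nu G :=
  (nu_isGreatest G).2 ⟨T, ⟨fun _ ht => mem_triangles.1 (hT ht),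
    fun _ hs _ ht hst => hdisj hs ht hst⟩, rfl⟩

theorem tau_le_card {F : Finset (Sym2 V)} (hF : ∀ t ∈ triangles G, ∃ e ∈ F, e ∈ spannedEdges t) :
    tau G ≤ #F := by
  classical
  refine le_trans ((tau_isLeast G).2 ⟨{e ∈ F | e ∈ G.edgeSet}, ⟨by simp, fun t ht => ?_⟩, rfl⟩)
    (Finset.card_filter_le _ _)
  obtain ⟨e, heF, het⟩ := hF t (mem_triangles.2 ht)
  have heG : e ∈ G.edgeSet :=
    SimpleGraph.edgeSet_mono (cliqueOn_le_iff.2 ht.isClique) (by rwa [edgeSet_cliqueOn])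
  exact ⟨e, by simp [heF, heG], het⟩

theorem tau_le_card_add_card {F : Finset (Sym2 V)} {L : Finset (Finset V)}
    (hF : ∀ t ∈ triangles G, t ∉ L → ∃ e ∈ F, e ∈ spannedEdges t) : tau G ≤ #F + #L := by
  classical
  induction L using Finset.induction_on generalizing F with
  | empty => simpa using tau_le_card (G := G) (by simpa using hF)
  | insert t L htL ih =>
    have hedge : ∃ F' : Finset (Sym2 V), F ⊆ F' ∧ #F' ≤ #F + 1 ∧
        (t ∈ triangles G → ∃ e ∈ F', e ∈ spannedEdges t) := by
      by_cases ht : t ∈ triangles G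
      · obtain ⟨e, he⟩ := exists_mem_spannedEdges (t := t)
          (by simp [(mem_triangles.1 ht).card_eq])
        exact ⟨insert e F, Finset.subset_insert _ _, Finset.card_insert_le _ _,
          fun _ => ⟨e, Finset.mem_insert_self _ _, he⟩⟩
      · exact ⟨F, subset_rfl, Nat.le_succ _, fun h => absurd h ht⟩
    obtain ⟨F', hFF', hcard, ht⟩ := hedge
    have hF' : tau G ≤ #F' + #L := by
      refine ih fun s hs hsL => ?_
      obtain rfl | hst := eq_or_ne s t
      · exact ht hs
      · obtain ⟨e, he, hes⟩ := hF s hs (by simp [hst, hsL])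
        exact ⟨e, hFF' he, hes⟩
    rw [Finset.card_insert_of_notMem htL]
    lia

theorem nu_mono : Monotone (nu (V := V)) := fun G G' h => by
  obtain ⟨T, ⟨hT, hdisj⟩, hcard⟩ := (nu_isGreatest G).1
  rw [← hcard]
  exact card_le_nu (fun t ht => mem_triangles.2 ((hT t ht).mono h)) hdisj

theorem nu_le_tau (G : SimpleGraph V) : nu G ≤ tau G := by
  obtain ⟨T, ⟨hT, hdisj⟩, hTcard⟩ := (nu_isGreatest G).1
  obtain ⟨F, ⟨-, hF⟩, hFcard⟩ := (tau_isLeast G).1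
  rw [← hTcard, ← hFcard]
  refine Finset.card_le_card_of_forall_subsingleton (fun t e => e ∈ spannedEdges t)
    (fun t ht => hF t (hT t ht)) fun e _ t ht t' ht' => ?_
  by_contra hne
  exact Set.disjoint_left.1 (hdisj t ht.1 t' ht'.1 hne) ht.2 ht'.2

theorem monotone_card_triangles_sub_tau :
    Monotone fun G : SimpleGraph V => (#(triangles G) : ℝ) - tau G := fun G G' h => by
  classical
  obtain ⟨F, ⟨-, hF⟩, hFcard⟩ := (tau_isLeast G).1
  have hcover : tau G' ≤ #F + #(triangles G' \ triangles G) :=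
    tau_le_card_add_card fun t ht' ht =>
      hF t (mem_triangles.1 (by simpa [ht'] using ht))
  have hcard := Finset.card_sdiff_add_card_eq_card (triangles_mono h)
  have : (tau G' : ℝ) + #(triangles G) ≤ tau G + #(triangles G') := by
    exact_mod_cast (by lia : tau G' + #(triangles G) ≤ tau G + #(triangles G'))
  simp only
  linarith

end Triangles

section Peelable

/-- A family of triangles is peelable if every nonempty subfamily contains a triangle `t` with a
vertex `v` such that the two edges of `t` at `v` lie in no other member of the subfamily: another
member through `v` has no second vertex in common with `t`. -/
def IsPeelable (S : Finset (Finset V)) : Prop :=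
  ∀ S' ⊆ S, S'.Nonempty → ∃ t ∈ S', ∃ v ∈ t, ∀ t' ∈ S', t' ≠ t → v ∈ t' → ∀ x ∈ t, x ∈ t' → x = v

theorem IsPeelable.mono {S S' : Finset (Finset V)} (hS : IsPeelable S) (h : S' ⊆ S) :
    IsPeelable S' :=
  fun S'' h' => hS S'' (h'.trans h)

theorem disjoint_spannedEdges_of_not_erase_subset [DecidableEq V] {t t' : Finset V} {v : V}
    (ht : #t = 3) (hvt : v ∈ t) (hv : v ∈ t' → ∀ x ∈ t, x ∈ t' → x = v) (hopp : ¬ t.erase v ⊆ t') :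
    Disjoint (spannedEdges t) (spannedEdges t') := by
  rw [disjoint_spannedEdges_iff]
  by_cases hvt' : v ∈ t'
  · have heq : ∀ x ∈ t ∩ t', x = v := fun x hx =>
      hv hvt' x (Finset.mem_of_mem_inter_left hx) (Finset.mem_of_mem_inter_right hx)
    exact Finset.card_le_one.2 fun x hx y hy => (heq x hx).trans (heq y hy).symm
  · have hssub : t ∩ t' ⊂ t.erase v := by
      refine Finset.ssubset_iff_subset_ne.2 ⟨fun x hx => ?_, fun h => ?_⟩
      · obtain ⟨hxt, hxt'⟩ := Finset.mem_inter.1 hx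
        exact Finset.mem_erase.2 ⟨fun h => hvt' (h ▸ hxt'), hxt⟩
      · exact hopp (h ▸ Finset.inter_subset_right)
    have hlt := Finset.card_lt_card hssub
    rw [Finset.card_erase_of_mem hvt, ht] at hlt
    lia

-- Peeling removes all triangles through the edge of `t` opposite to `v`: this edge covers them,
-- and `t` is edge-disjoint from every triangle that remains.
theorem IsPeelable.exists_cover_matching {S : Finset (Finset V)} (hS : IsPeelable S)
    (hcard : ∀ t ∈ S, #t = 3) :
    ∃ F : Finset (Sym2 V), ∃ T ⊆ S, (T : Set (Finset V)).PairwiseDisjoint spannedEdges ∧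
      (∀ t ∈ S, ∃ e ∈ F, e ∈ spannedEdges t) ∧ #F ≤ #T := by
  classical
  induction S using Finset.strongInduction with
  | H S ih =>
    obtain rfl | hne := S.eq_empty_or_nonempty
    · exact ⟨∅, ∅, by simp⟩
    obtain ⟨t, htS, v, hvt, hpendant⟩ := hS S subset_rfl hne
    have hopp : #(t.erase v) = 2 := by rw [Finset.card_erase_of_mem hvt, hcard t htS]
    obtain ⟨a, b, hab, hopp_eq⟩ := Finset.card_eq_two.1 hopp
    let R := {t' ∈ S | ¬ t.erase v ⊆ t'}
    have htR : t ∉ R := by simp [R, Finset.erase_subset]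
    have hRS : R ⊆ S := Finset.filter_subset _ _
    obtain ⟨F, T, hTR, hTdisj, hF, hFT⟩ :=
      ih R (hRS.ssubset_of_mem_notMem htS htR) (hS.mono hRS) fun t' ht' => hcard t' (hRS ht')
    have htT : t ∉ T := fun h => htR (hTR h)
    have hdisj : ∀ t' ∈ R, Disjoint (spannedEdges t) (spannedEdges t') := fun t' ht' => by
      obtain ⟨ht'S, hopp'⟩ := Finset.mem_filter.1 ht'
      have hne' : t' ≠ t := fun h => htR (h ▸ ht')
      exact disjoint_spannedEdges_of_not_erase_subset (hcard t htS) hvt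
        (hpendant t' ht'S hne') hopp'
    refine ⟨insert s(a, b) F, insert t T, Finset.insert_subset htS (hTR.trans hRS), ?_, ?_, ?_⟩
    · rw [Finset.coe_insert, Set.pairwiseDisjoint_insert]
      exact ⟨hTdisj, fun t' ht' _ => hdisj t' (hTR ht')⟩
    · intro t' ht'
      by_cases hsub : t.erase v ⊆ t'
      · rw [hopp_eq] at hsub
        exact ⟨s(a, b), Finset.mem_insert_self _ _, mk_mem_spannedEdges.2
          ⟨hab, hsub (by simp), hsub (by simp)⟩⟩
      · obtain ⟨e, he, het⟩ := hF t' (Finset.mem_filter.2 ⟨ht', hsub⟩)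
        exact ⟨e, Finset.mem_insert_of_mem he, het⟩
    · rw [Finset.card_insert_of_notMem htT]
      exact (Finset.card_insert_le _ _).trans (Nat.succ_le_succ hFT)

open scoped Classical in
theorem tau_le_nu_add_card [Fintype V] {G : SimpleGraph V} {L : Finset (Finset V)}
    (h : IsPeelable (triangles G \ L)) : tau G ≤ nu G + #L := by
  obtain ⟨F, T, hT, hdisj, hF, hcard⟩ := h.exists_cover_matching fun t ht =>
    (mem_triangles.1 (Finset.sdiff_subset ht)).card_eq
  calc tau G ≤ #F + #L := tau_le_card_add_card fun t ht htL => hF t (by simp [ht, htL])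
    _ ≤ #T + #L := by gcongr
    _ ≤ nu G + #L := by gcongr; exact card_le_nu (hT.trans Finset.sdiff_subset) hdisj

end Peelable

section StackedWalks

/-- A walk of triangles, each glued to an edge of its predecessor at the tip of the latter through
a new vertex, its own tip. Only the data needed to continue the walk is recorded: the union of the
triangles, their vertices, the last triangle and its tip. -/
structure StackedWalk (V : Type*) where
  graph : SimpleGraph V
  verts : Finset V
  last : Finset V
  tip : V

theorem ncard_edgeSet_sup_edge [Finite V] {G : SimpleGraph V} {u v : V}
    (huv : u ≠ v) (hG : ¬ G.Adj u v) :
    (G ⊔ .edge u v).edgeSet.ncard = G.edgeSet.ncard + 1 := by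
  rw [SimpleGraph.edgeSet_sup, SimpleGraph.edgeSet_edge_of_ne huv, Set.union_singleton,
    Set.ncard_insert_of_notMem (by simpa using hG)]

namespace StackedWalk

/-- The walk consisting of the single triangle `t`, with tip `v`. -/
def start (t : Finset V) (v : V) : StackedWalk V :=
  ⟨cliqueOn t, t, t, v⟩

open scoped Classical in
/-- The walk `σ` continued by the triangle on the edge `{x, σ.tip}` with tip `z`. -/
noncomputable def extend (σ : StackedWalk V) (x z : V) : StackedWalk V :=
  ⟨σ.graph ⊔ .edge z x ⊔ .edge z σ.tip, insert z σ.verts, {x, σ.tip, z}, z⟩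

/-- The invariants of a stacked walk with `k + 1` triangles. -/
structure IsValid (σ : StackedWalk V) (k : ℕ) : Prop where
  ncard_edgeSet : σ.graph.edgeSet.ncard = 2 * k + 3
  card_verts : #σ.verts = k + 3
  card_last : #σ.last = 3
  last_subset : σ.last ⊆ σ.verts
  tip_mem : σ.tip ∈ σ.last
  mem_verts {u v : V} : σ.graph.Adj u v → u ∈ σ.verts
  mem_last {v : V} : σ.graph.Adj σ.tip v → v ∈ σ.last

theorem isValid_start {t : Finset V} {v : V} (ht : #t = 3) (hv : v ∈ t) :
    (start t v).IsValid 0 where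
  ncard_edgeSet := by simp [start, ncard_edgeSet_cliqueOn, ht]
  card_verts := ht
  card_last := ht
  last_subset := subset_rfl
  tip_mem := hv
  mem_verts h := (cliqueOn_adj.1 h).2.1
  mem_last h := (cliqueOn_adj.1 h).2.2

theorem IsValid.extend [Finite V] {σ : StackedWalk V} {k : ℕ} (h : σ.IsValid k) {x z : V}
    (hx : x ∈ σ.last) (hxt : x ≠ σ.tip)
    (hz : z ∉ σ.verts) : (σ.extend x z).IsValid (k + 1) := by
  classical
  have hxv : x ∈ σ.verts := h.last_subset hx
  have htv : σ.tip ∈ σ.verts := h.last_subset h.tip_mem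
  have hzx : z ≠ x := fun e => hz (e ▸ hxv)
  have hzt : z ≠ σ.tip := fun e => hz (e ▸ htv)
  have hzadj (v : V) : ¬ σ.graph.Adj z v := fun hv => hz (h.mem_verts hv)
  refine ⟨?_, ?_, ?_, ?_, ?_, fun {u v} huv => ?_, fun {v} hv => ?_⟩
  · have hzt' : ¬ (σ.graph ⊔ .edge z x).Adj z σ.tip := by
      simp [SimpleGraph.sup_adj, SimpleGraph.edge_adj, hzadj, hxt.symm, hzx, hzt.symm]
    rw [StackedWalk.extend, ncard_edgeSet_sup_edge hzt hzt', ncard_edgeSet_sup_edge hzx (hzadj x),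
      h.ncard_edgeSet]
    ring
  · simp [StackedWalk.extend, hz, h.card_verts]
  · exact Finset.card_eq_three.2 ⟨x, σ.tip, z, hxt, hzx.symm, hzt.symm, rfl⟩
  · simp only [StackedWalk.extend]
    grind
  · simp [StackedWalk.extend]
  · have := h.mem_verts (u := u) (v := v)
    simp only [StackedWalk.extend, SimpleGraph.sup_adj, SimpleGraph.edge_adj] at huv ⊢
    grind
  · simp only [StackedWalk.extend, SimpleGraph.sup_adj, SimpleGraph.edge_adj] at hv ⊢
    grind

end StackedWalk

open scoped Classical in
/-- The stacked walks with `k + 1` triangles. -/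
noncomputable def stackedWalks (V : Type*) [Fintype V] : ℕ → Finset (StackedWalk V)
  | 0 => (Finset.univ.powersetCard 3).biUnion fun t => t.image (.start t)
  | k + 1 => (stackedWalks V k).biUnion fun σ =>
      (σ.last.erase σ.tip ×ˢ σ.vertsᶜ).image fun y => σ.extend y.1 y.2

open scoped Classical in
/-- The stacked walks with `k + 1` triangles followed by a further triangle at the tip whose third
vertex is old. Recorded are the union of the walk and a new edge at the tip of this closing
triangle, and the closing triangle itself. -/
noncomputable def closedWalks (V : Type*) [Fintype V] (k : ℕ) : Finset (SimpleGraph V × Finset V) :=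
  (stackedWalks V k).biUnion fun σ =>
    (σ.last.erase σ.tip ×ˢ (σ.verts \ σ.last)).image fun y =>
      (σ.graph ⊔ .edge σ.tip y.2, (σ.extend y.1 y.2).last)

variable [Fintype V]

theorem mem_stackedWalks_zero {σ : StackedWalk V} :
    σ ∈ stackedWalks V 0 ↔ ∃ t : Finset V, #t = 3 ∧ ∃ v ∈ t, .start t v = σ := by
  simp [stackedWalks]

theorem mem_stackedWalks_succ {σ : StackedWalk V} {k : ℕ} :
    σ ∈ stackedWalks V (k + 1) ↔
      ∃ ρ ∈ stackedWalks V k, ∃ x ∈ ρ.last, x ≠ ρ.tip ∧ ∃ z ∉ ρ.verts, ρ.extend x z = σ := by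
  simp only [stackedWalks, Finset.mem_biUnion, Finset.mem_image, Finset.mem_product,
    Finset.mem_erase, Finset.mem_compl, Prod.exists]
  grind

theorem mem_closedWalks {c : SimpleGraph V × Finset V} {k : ℕ} :
    c ∈ closedWalks V k ↔
      ∃ σ ∈ stackedWalks V k, ∃ x ∈ σ.last, x ≠ σ.tip ∧ ∃ z ∈ σ.verts, z ∉ σ.last ∧
        (σ.graph ⊔ .edge σ.tip z, (σ.extend x z).last) = c := by
  simp only [closedWalks, Finset.mem_biUnion, Finset.mem_image, Finset.mem_product,
    Finset.mem_erase, Finset.mem_sdiff, Prod.exists]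
  grind

theorem isValid_of_mem_stackedWalks {σ : StackedWalk V} {k : ℕ} (hσ : σ ∈ stackedWalks V k) :
    σ.IsValid k := by
  induction k generalizing σ with
  | zero =>
    obtain ⟨t, ht, v, hv, rfl⟩ := mem_stackedWalks_zero.1 hσ
    exact StackedWalk.isValid_start ht hv
  | succ k ih =>
    obtain ⟨ρ, hρ, x, hx, hxt, z, hz, rfl⟩ := mem_stackedWalks_succ.1 hσ
    exact (ih hρ).extend hx hxt hz

theorem card_stackedWalks_le (k : ℕ) :
    #(stackedWalks V k) ≤
      (Fintype.card V).choose 3 * 3 * (2 * (Fintype.card V - 2)) ^ k := by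
  classical
  induction k with
  | zero =>
    rw [pow_zero, mul_one, ← Finset.card_univ, ← Finset.card_powersetCard]
    exact Finset.card_biUnion_le_card_mul _ _ _ fun t ht =>
      Finset.card_image_le.trans (Finset.mem_powersetCard.1 ht).2.le
  | succ k ih =>
    rw [stackedWalks, pow_succ, ← mul_assoc]
    refine (Finset.card_biUnion_le_card_mul _ _ _ fun σ hσ => ?_).trans
      (Nat.mul_le_mul_right _ ih)
    have h := isValid_of_mem_stackedWalks hσ
    refine Finset.card_image_le.trans ?_
    rw [Finset.card_product, Finset.card_erase_of_mem h.tip_mem, h.card_last, Finset.card_compl,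
      h.card_verts]
    exact Nat.mul_le_mul le_rfl (by lia)

theorem card_closedWalks_le (k : ℕ) :
    #(closedWalks V k) ≤
      (Fintype.card V).choose 3 * 3 * (2 * (Fintype.card V - 2)) ^ k * (2 * k) := by
  classical
  refine (Finset.card_biUnion_le_card_mul _ _ (2 * k) fun σ hσ => ?_).trans
    (Nat.mul_le_mul_right _ (card_stackedWalks_le k))
  have h := isValid_of_mem_stackedWalks hσ
  refine Finset.card_image_le.trans ?_
  rw [Finset.card_product, Finset.card_erase_of_mem h.tip_mem, h.card_last,
    Finset.card_sdiff_of_subset h.last_subset, h.card_verts, h.card_last]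
  simp

theorem ncard_edgeSet_of_mem_closedWalks {k : ℕ} {c : SimpleGraph V × Finset V}
    (hc : c ∈ closedWalks V k) : c.1.edgeSet.ncard = 2 * k + 4 := by
  obtain ⟨σ, hσ, x, -, -, z, -, hz, rfl⟩ := mem_closedWalks.1 hc
  have h := isValid_of_mem_stackedWalks hσ
  have hne : σ.tip ≠ z := fun e => hz (e ▸ h.tip_mem)
  rw [ncard_edgeSet_sup_edge hne fun hadj => hz (h.mem_last hadj), h.ncard_edgeSet]

open scoped Classical in
/-- The closing triangles of the closed walks contained in `G`. -/
noncomputable def closingTriangles (G : SimpleGraph V) : Finset (Finset V) :=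
  (Finset.range (Fintype.card V)).biUnion fun k =>
    {c ∈ closedWalks V k | c.1 ≤ G}.image Prod.snd

theorem mem_closingTriangles {G : SimpleGraph V} {t : Finset V} :
    t ∈ closingTriangles G ↔
      ∃ k < Fintype.card V, ∃ H ≤ G, (H, t) ∈ closedWalks V k := by
  simp only [closingTriangles, Finset.mem_biUnion, Finset.mem_range, Finset.mem_image,
    Finset.mem_filter, Prod.exists]
  grind

theorem card_closingTriangles_le (G : SimpleGraph V) :
    #(closingTriangles G) ≤
      ∑ k ∈ Finset.range (Fintype.card V), subgraphCount (closedWalks V k) Prod.fst G := by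
  classical
  exact Finset.card_biUnion_le.trans (Finset.sum_le_sum fun k _ => by
    unfold subgraphCount; convert Finset.card_image_le)

theorem mem_closingTriangles_or_exists_extend {G : SimpleGraph V} {k : ℕ} {σ : StackedWalk V}
    (hσ : σ ∈ stackedWalks V k) (hσG : σ.graph ≤ G) {t : Finset V} (ht : G.IsNClique 3 t)
    (hlast : t ≠ σ.last) (htip : σ.tip ∈ t) {x : V} (hx : x ∈ σ.last) (hxt : x ∈ t)
    (hxtip : x ≠ σ.tip) :
    t ∈ closingTriangles G ∨ ∃ ρ ∈ stackedWalks V (k + 1), ρ.graph ≤ G ∧ ρ.last = t := by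
  classical
  have h := isValid_of_mem_stackedWalks hσ
  obtain ⟨z, hz⟩ : ∃ z, (t.erase σ.tip).erase x = {z} := by
    rw [← Finset.card_eq_one, Finset.card_erase_of_mem (by grind), Finset.card_erase_of_mem htip,
      ht.card_eq]
  have hzmem : z ∈ (t.erase σ.tip).erase x := by simp [hz]
  obtain ⟨hzx, hztip, hzt⟩ : z ≠ x ∧ z ≠ σ.tip ∧ z ∈ t := by simpa using hzmem
  have ht_eq : (σ.extend x z).last = t := by
    rw [StackedWalk.extend, ← hz, Finset.insert_comm, Finset.insert_erase (by grind),
      Finset.insert_erase htip]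
  have hzx_adj : G.Adj z x := ht.isClique hzt hxt hzx
  have hztip_adj : G.Adj z σ.tip := ht.isClique hzt htip hztip
  by_cases hzv : z ∈ σ.verts
  · left
    have hzlast : z ∉ σ.last := fun hzl =>
      hlast (Finset.eq_of_subset_of_card_le (by rw [← ht_eq, StackedWalk.extend]; grind [h.tip_mem])
        (by rw [h.card_last, ht.card_eq]))
    have hk : k < Fintype.card V := by
      have := h.card_verts ▸ Finset.card_le_univ σ.verts
      lia
    have hle : σ.graph ⊔ .edge σ.tip z ≤ G :=
      sup_le hσG ((SimpleGraph.edge_le_iff _).2 (.inr hztip_adj.symm))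
    exact mem_closingTriangles.2 ⟨k, hk, _, hle, mem_closedWalks.2
      ⟨σ, hσ, x, hx, hxtip, z, hzv, hzlast, Prod.ext rfl ht_eq⟩⟩
  · right
    refine ⟨σ.extend x z, mem_stackedWalks_succ.2 ⟨σ, hσ, x, hx, hxtip, z, hzv, rfl⟩, ?_, ht_eq⟩
    exact sup_le (sup_le hσG ((SimpleGraph.edge_le_iff _).2 (.inr hzx_adj)))
      ((SimpleGraph.edge_le_iff _).2 (.inr hztip_adj))

-- In a subfamily violating the peeling condition the walk can be continued at every tip, until it
-- has more triangles than there are vertices.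
open scoped Classical in
theorem isPeelable_triangles_sdiff_closingTriangles (G : SimpleGraph V) :
    IsPeelable (triangles G \ closingTriangles G) := by
  intro S hS ⟨t₀, ht₀⟩
  by_contra! hstuck
  have hclique : ∀ t ∈ S, G.IsNClique 3 t := fun t ht =>
    mem_triangles.1 (Finset.sdiff_subset (hS ht))
  have hwalk (k : ℕ) : ∃ σ ∈ stackedWalks V k, σ.graph ≤ G ∧ σ.last ∈ S := by
    induction k with
    | zero =>
      obtain ⟨v, hv⟩ : t₀.Nonempty := Finset.card_pos.1 (by simp [(hclique t₀ ht₀).card_eq])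
      exact ⟨.start t₀ v, mem_stackedWalks_zero.2 ⟨t₀, (hclique t₀ ht₀).card_eq, v, hv, rfl⟩,
        cliqueOn_le_iff.2 (hclique t₀ ht₀).isClique, ht₀⟩
    | succ k ih =>
      obtain ⟨σ, hσ, hσG, hσS⟩ := ih
      obtain ⟨t, ht, hlast, htip, x, hx, hxt, hxtip⟩ :=
        hstuck σ.last hσS σ.tip (isValid_of_mem_stackedWalks hσ).tip_mem
      obtain hclosing | ⟨ρ, hρ, hρG, rfl⟩ :=
        mem_closingTriangles_or_exists_extend hσ hσG (hclique t ht) hlast htip hx hxt hxtip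
      · exact absurd hclosing (Finset.mem_sdiff.1 (hS ht)).2
      · exact ⟨ρ, hρ, hρG, ht⟩
  obtain ⟨σ, hσ, -⟩ := hwalk (Fintype.card V)
  have := (isValid_of_mem_stackedWalks hσ).card_verts ▸ Finset.card_le_univ σ.verts
  lia

theorem tau_le_nu_add_card_closingTriangles (G : SimpleGraph V) :
    tau G ≤ nu G + #(closingTriangles G) :=
  tau_le_nu_add_card (isPeelable_triangles_sdiff_closingTriangles G)

end StackedWalks

section Expectations

/-- The expected number of triangles of `G(V, p)`. -/
noncomputable def expTriangles (V : Type*) [Fintype V] (p : unitInterval) : ℝ :=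
  (Fintype.card V).choose 3 * (p : ℝ) ^ 3

/-- The expected number of common neighbours of two distinct vertices of `G(V, p)`. The truncated
subtraction only matters when there are no such vertices. -/
noncomputable def expCodegree (V : Type*) [Fintype V] (p : unitInterval) : ℝ :=
  ((Fintype.card V - 2 : ℕ) : ℝ) * (p : ℝ) ^ 2

variable [Fintype V] (p : unitInterval)

theorem expTriangles_nonneg : 0 ≤ expTriangles V p := by
  have := p.2.1
  unfold expTriangles
  positivity

theorem expCodegree_nonneg : 0 ≤ expCodegree V p := by
  unfold expCodegree
  positivity

theorem expTriangles_mul (q : unitInterval) :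
    expTriangles V (q * p) = (q : ℝ) ^ 3 * expTriangles V p := by
  rw [expTriangles, expTriangles, Set.Icc.coe_mul]
  ring

theorem expCodegree_mul (q : unitInterval) :
    expCodegree V (q * p) = (q : ℝ) ^ 2 * expCodegree V p := by
  rw [expCodegree, expCodegree, Set.Icc.coe_mul]
  ring

theorem integral_card_triangles :
    ∫ G, (#(triangles G) : ℝ) ∂G(V, p) = expTriangles V p := by
  simp_rw [card_triangles]
  rw [integral_subgraphCount, Finset.sum_congr rfl fun t ht => by
    rw [ncard_edgeSet_cliqueOn, (Finset.mem_powersetCard.1 ht).2]]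
  simp [expTriangles]

theorem sum_range_mul_pow_le {x : ℝ} (hx₀ : 0 ≤ x) (hx₁ : x < 1) (n : ℕ) :
    ∑ k ∈ Finset.range n, k * x ^ k ≤ 1 / (1 - x) ^ 2 :=
  calc ∑ k ∈ Finset.range n, k * x ^ k ≤ x / (1 - x) ^ 2 :=
        sum_le_hasSum _ (fun k _ => by positivity)
          (hasSum_coe_mul_geometric_of_norm_lt_one (by rwa [Real.norm_of_nonneg hx₀]))
    _ ≤ 1 / (1 - x) ^ 2 := by gcongr

theorem integral_subgraphCount_closedWalks_le (k : ℕ) :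
    ∫ G, (subgraphCount (closedWalks V k) Prod.fst G : ℝ) ∂G(V, p) ≤
      6 * expTriangles V p * p * (k * (2 * expCodegree V p) ^ k) := by
  have hp := p.2.1
  rw [integral_subgraphCount, Finset.sum_congr rfl fun c hc => by
    rw [ncard_edgeSet_of_mem_closedWalks hc], Finset.sum_const, nsmul_eq_mul]
  calc (#(closedWalks V k) : ℝ) * (p : ℝ) ^ (2 * k + 4)
      ≤ ((Fintype.card V).choose 3 * 3 * (2 * (Fintype.card V - 2 : ℕ)) ^ k * (2 * k)) *
          (p : ℝ) ^ (2 * k + 4) := by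
        gcongr
        exact_mod_cast card_closedWalks_le k
    _ = 6 * expTriangles V p * p * (k * (2 * expCodegree V p) ^ k) := by
        unfold expTriangles expCodegree
        ring

theorem integral_card_closingTriangles_le (hd : 2 * expCodegree V p < 1) :
    ∫ G : SimpleGraph V, (#(closingTriangles G) : ℝ) ∂G(V, p) ≤
      6 * expTriangles V p * p / (1 - 2 * expCodegree V p) ^ 2 := by
  have hp := p.2.1
  have hμ := expTriangles_nonneg (V := V) p
  calc ∫ G : SimpleGraph V, (#(closingTriangles G) : ℝ) ∂G(V, p)
      ≤ ∫ G, ∑ k ∈ Finset.range (Fintype.card V),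
          (subgraphCount (closedWalks V k) Prod.fst G : ℝ) ∂G(V, p) :=
        integral_mono .of_finite .of_finite fun G => by
          dsimp only
          exact_mod_cast card_closingTriangles_le G
    _ = ∑ k ∈ Finset.range (Fintype.card V),
          ∫ G, (subgraphCount (closedWalks V k) Prod.fst G : ℝ) ∂G(V, p) :=
        integral_finsetSum _ fun _ _ => .of_finite
    _ ≤ ∑ k ∈ Finset.range (Fintype.card V),
          6 * expTriangles V p * p * (k * (2 * expCodegree V p) ^ k) :=
        Finset.sum_le_sum fun k _ => integral_subgraphCount_closedWalks_le p k
    _ ≤ 6 * expTriangles V p * p * (1 / (1 - 2 * expCodegree V p) ^ 2) := by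
        rw [← Finset.mul_sum]
        gcongr
        exact sum_range_mul_pow_le (by linarith [expCodegree_nonneg (V := V) p]) hd _
    _ = 6 * expTriangles V p * p / (1 - 2 * expCodegree V p) ^ 2 := by ring

theorem integral_tau_sub_nu_le_of_expCodegree_lt (hd : 2 * expCodegree V p < 1) :
    ∫ G : SimpleGraph V, ((tau G : ℝ) - nu G) ∂G(V, p) ≤
      6 * expTriangles V p * p / (1 - 2 * expCodegree V p) ^ 2 :=
  (integral_mono .of_finite .of_finite fun G => by
    have : (tau G : ℝ) ≤ nu G + #(closingTriangles G) :=
      mod_cast tau_le_nu_add_card_closingTriangles G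
    simp only
    linarith).trans (integral_card_closingTriangles_le p hd)

theorem integral_tau_sub_nu_le_mul (q : unitInterval) :
    ∫ G : SimpleGraph V, ((tau G : ℝ) - nu G) ∂G(V, p) ≤
      ∫ G : SimpleGraph V, ((tau G : ℝ) - nu G) ∂G(V, q * p) +
        (1 - (q : ℝ) ^ 3) * expTriangles V p := by
  have hτ := integral_binomialRandom_mul_le (monotone_card_triangles_sub_tau (V := V)) q p
  have hν := integral_binomialRandom_mul_le
    (f := fun G : SimpleGraph V => (nu G : ℝ)) (fun _ _ h => Nat.cast_le.2 (nu_mono h)) q p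
  simp only [integral_sub Integrable.of_finite Integrable.of_finite, integral_card_triangles,
    expTriangles_mul] at hτ ⊢
  linarith

theorem integral_tau_sub_nu_le (hd : expCodegree V p ≤ 1 / 2) {δ : unitInterval} (hδ : 0 < δ) :
    ∫ G : SimpleGraph V, ((tau G : ℝ) - nu G) ∂G(V, p) ≤
      expTriangles V p * (3 * δ + 6 * p / (δ : ℝ) ^ 2) := by
  have hδ₀ : (0 : ℝ) < δ := hδ
  have hp := p.2.1
  have hμ := expTriangles_nonneg (V := V) p
  have hσ : (unitInterval.symm δ : ℝ) = 1 - δ := unitInterval.coe_symm_eq δ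
  have hσ₀ : (0 : ℝ) ≤ 1 - δ := by linarith [δ.2.2]
  have hσ₁ : (1 - δ : ℝ) ≤ 1 := by linarith
  have hcodegree : δ ≤ 1 - 2 * expCodegree V (unitInterval.symm δ * p) := by
    rw [expCodegree_mul, hσ]
    nlinarith [pow_le_of_le_one hσ₀ hσ₁ two_ne_zero]
  have hthinned := integral_tau_sub_nu_le_of_expCodegree_lt (V := V) (unitInterval.symm δ * p)
    (by linarith)
  calc ∫ G : SimpleGraph V, ((tau G : ℝ) - nu G) ∂G(V, p)
      ≤ 6 * expTriangles V (unitInterval.symm δ * p) * (unitInterval.symm δ * p : unitInterval) /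
          (1 - 2 * expCodegree V (unitInterval.symm δ * p)) ^ 2 +
        (1 - (1 - δ : ℝ) ^ 3) * expTriangles V p := by
        have := integral_tau_sub_nu_le_mul (V := V) p (unitInterval.symm δ)
        rw [hσ] at this
        linarith
    _ ≤ 6 * expTriangles V p * p / (δ : ℝ) ^ 2 + 3 * δ * expTriangles V p := by
        have hthin : expTriangles V (unitInterval.symm δ * p) ≤ expTriangles V p := by
          rw [expTriangles_mul, hσ]
          exact mul_le_of_le_one_left hμ (pow_le_one₀ hσ₀ hσ₁)
        have hprob : ((unitInterval.symm δ * p : unitInterval) : ℝ) ≤ p := by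
          rw [Set.Icc.coe_mul, hσ]
          exact mul_le_of_le_one_left hp hσ₁
        have hcube : 1 - (1 - δ : ℝ) ^ 3 ≤ 3 * δ := by nlinarith [sq_nonneg (δ : ℝ)]
        gcongr
        exact (unitInterval.symm δ * p).2.1
    _ = expTriangles V p * (3 * δ + 6 * p / (δ : ℝ) ^ 2) := by ring

theorem integral_tau_sub_nu_le_of_le_pow (hd : expCodegree V p ≤ 1 / 2) {δ : unitInterval}
    (hδ : 0 < δ) (hp : p ≤ δ ^ 3) :
    ∫ G : SimpleGraph V, ((tau G : ℝ) - nu G) ∂G(V, p) ≤ 9 * δ * expTriangles V p := by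
  have hδ₀ : (0 : ℝ) < δ := hδ
  have hp' : (p : ℝ) ≤ (δ : ℝ) ^ 3 := hp
  have hμ := expTriangles_nonneg (V := V) p
  calc ∫ G : SimpleGraph V, ((tau G : ℝ) - nu G) ∂G(V, p)
      ≤ expTriangles V p * (3 * δ + 6 * p / (δ : ℝ) ^ 2) := integral_tau_sub_nu_le p hd hδ
    _ ≤ expTriangles V p * (3 * δ + 6 * (δ : ℝ) ^ 3 / (δ : ℝ) ^ 2) := by gcongr
    _ = 9 * δ * expTriangles V p := by
        field_simp
        ring

end Expectations

section SharingPairs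

open scoped Classical in
/-- The ordered pairs of distinct three-element sets that span a common edge. -/
noncomputable def sharingPairs (V : Type*) [Fintype V] : Finset (Finset V × Finset V) :=
  {x ∈ Finset.univ.powersetCard 3 ×ˢ Finset.univ.powersetCard 3 |
    x.1 ≠ x.2 ∧ ¬ Disjoint (spannedEdges x.1) (spannedEdges x.2)}

/-- The number of ordered pairs of distinct triangles of `G` that share an edge. -/
noncomputable def sharingCount [Fintype V] (G : SimpleGraph V) : ℕ :=
  subgraphCount (sharingPairs V) (fun x => cliqueOn x.1 ⊔ cliqueOn x.2) G

variable [Fintype V]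

theorem mem_sharingPairs {x : Finset V × Finset V} :
    x ∈ sharingPairs V ↔ #x.1 = 3 ∧ #x.2 = 3 ∧ x.1 ≠ x.2 ∧
      ¬ Disjoint (spannedEdges x.1) (spannedEdges x.2) := by
  simp [sharingPairs, and_assoc]

theorem card_inter_of_mem_sharingPairs [DecidableEq V] {x : Finset V × Finset V}
    (hx : x ∈ sharingPairs V) : #(x.1 ∩ x.2) = 2 := by
  obtain ⟨h₁, h₂, hne, hdisj⟩ := mem_sharingPairs.1 hx
  rw [disjoint_spannedEdges_iff] at hdisj
  have hle : #(x.1 ∩ x.2) ≤ 3 := h₁ ▸ Finset.card_le_card Finset.inter_subset_left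
  have hne3 : #(x.1 ∩ x.2) ≠ 3 := fun h => hne <|
    (Finset.eq_of_subset_of_card_le Finset.inter_subset_left (h₁.trans h.symm).le).symm.trans
      (Finset.eq_of_subset_of_card_le Finset.inter_subset_right (h₂.trans h.symm).le)
  lia

theorem ncard_edgeSet_of_mem_sharingPairs {x : Finset V × Finset V} (hx : x ∈ sharingPairs V) :
    (cliqueOn x.1 ⊔ cliqueOn x.2).edgeSet.ncard = 5 := by
  classical
  obtain ⟨h₁, h₂, -⟩ := mem_sharingPairs.1 hx
  have hunion := Set.ncard_union_add_ncard_inter (spannedEdges x.1) (spannedEdges x.2)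
  rw [← spannedEdges_inter] at hunion
  simp only [ncard_spannedEdges, card_inter_of_mem_sharingPairs hx, h₁, h₂,
    show Nat.choose 3 2 = 3 from rfl, show Nat.choose 2 2 = 1 from rfl] at hunion
  rw [SimpleGraph.edgeSet_sup, edgeSet_cliqueOn, edgeSet_cliqueOn]
  lia

theorem exists_insert_erase_of_mem_sharingPairs [DecidableEq V] {x : Finset V × Finset V}
    (hx : x ∈ sharingPairs V) : ∃ u ∈ x.1, ∃ v ∉ x.1, insert v (x.1.erase u) = x.2 := by
  obtain ⟨h₁, h₂, -⟩ := mem_sharingPairs.1 hx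
  have hinter := card_inter_of_mem_sharingPairs hx
  obtain ⟨u, hu⟩ : ∃ u, x.1 \ x.2 = {u} := by
    rw [← Finset.card_eq_one]
    have := Finset.card_sdiff_add_card_inter x.1 x.2
    lia
  obtain ⟨v, hv⟩ : ∃ v, x.2 \ x.1 = {v} := by
    rw [← Finset.card_eq_one]
    have := Finset.card_sdiff_add_card_inter x.2 x.1
    rw [Finset.inter_comm] at this
    lia
  simp only [Finset.ext_iff, Finset.mem_sdiff, Finset.mem_singleton] at hu hv
  refine ⟨u, ((hu u).2 rfl).1, v, ((hv v).2 rfl).2, ?_⟩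
  ext w
  rw [Finset.mem_insert, Finset.mem_erase]
  grind

theorem card_sharingPairs_le :
    #(sharingPairs V) ≤ (Fintype.card V).choose 3 * (3 * (Fintype.card V - 3)) := by
  classical
  have hsub : sharingPairs V ⊆ (Finset.univ.powersetCard 3).biUnion fun t =>
      (t ×ˢ tᶜ).image fun y => (t, insert y.2 (t.erase y.1)) := fun x hx => by
    obtain ⟨u, hu, v, hv, huv⟩ := exists_insert_erase_of_mem_sharingPairs hx
    exact Finset.mem_biUnion.2 ⟨x.1, by simpa using (mem_sharingPairs.1 hx).1,
      Finset.mem_image.2 ⟨(u, v), by simp [hu, hv], Prod.ext rfl huv⟩⟩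
  rw [← Finset.card_univ (α := V), ← Finset.card_powersetCard]
  refine (Finset.card_le_card hsub).trans
    (Finset.card_biUnion_le_card_mul _ _ _ fun t ht => Finset.card_image_le.trans ?_)
  rw [Finset.card_product, Finset.card_compl, (Finset.mem_powersetCard.1 ht).2, Finset.card_univ]

theorem integral_sharingCount_le (p : unitInterval) :
    ∫ G : SimpleGraph V, (sharingCount G : ℝ) ∂G(V, p) ≤
      3 * expCodegree V p * expTriangles V p := by
  have hp := p.2.1
  unfold sharingCount
  rw [integral_subgraphCount, Finset.sum_congr rfl fun x hx => by
    rw [ncard_edgeSet_of_mem_sharingPairs hx], Finset.sum_const, nsmul_eq_mul]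
  calc (#(sharingPairs V) : ℝ) * (p : ℝ) ^ 5
      ≤ (Fintype.card V).choose 3 * (3 * (Fintype.card V - 2 : ℕ)) * (p : ℝ) ^ 5 := by
        gcongr
        exact_mod_cast card_sharingPairs_le.trans (by gcongr; simp)
    _ = 3 * expCodegree V p * expTriangles V p := by
        unfold expTriangles expCodegree
        ring

theorem card_triangles_le_nu_add_sharingCount (G : SimpleGraph V) :
    #(triangles G) ≤ nu G + sharingCount G := by
  classical
  let I := {t ∈ triangles G | ∀ t' ∈ triangles G, t ≠ t' →
    Disjoint (spannedEdges t) (spannedEdges t')}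
  have hI : #I ≤ nu G := card_le_nu (Finset.filter_subset _ _) fun t ht t' ht' =>
    (Finset.mem_filter.1 ht).2 t' (Finset.mem_filter.1 ht').1
  have hsub : triangles G \ I ⊆
      {x ∈ sharingPairs V | cliqueOn x.1 ⊔ cliqueOn x.2 ≤ G}.image Prod.fst := by
    intro t ht
    obtain ⟨htG, htI⟩ := Finset.mem_sdiff.1 ht
    obtain ⟨t', htG', hne, hdisj⟩ :
        ∃ t' ∈ triangles G, t ≠ t' ∧ ¬ Disjoint (spannedEdges t) (spannedEdges t') := by
      simpa [I, htG] using htI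
    rw [mem_triangles] at htG htG'
    exact Finset.mem_image.2 ⟨(t, t'), Finset.mem_filter.2
      ⟨mem_sharingPairs.2 ⟨htG.card_eq, htG'.card_eq, hne, hdisj⟩,
        sup_le (cliqueOn_le_iff.2 htG.isClique) (cliqueOn_le_iff.2 htG'.isClique)⟩, rfl⟩
  have hsharing : #(triangles G \ I) ≤ sharingCount G :=
    (Finset.card_le_card hsub).trans (by
      unfold sharingCount subgraphCount
      convert Finset.card_image_le)
  calc #(triangles G) = #(triangles G \ I) + #I :=
        (Finset.card_sdiff_add_card_eq_card (Finset.filter_subset _ _)).symm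
    _ ≤ nu G + sharingCount G := by lia

theorem variance_card_triangles_le (p : unitInterval) :
    Var[fun G : SimpleGraph V => (#(triangles G) : ℝ); G(V, p)] ≤
      expTriangles V p + ∫ G : SimpleGraph V, (sharingCount G : ℝ) ∂G(V, p) := by
  classical
  have hp := p.2.1
  let K : Finset (Finset V) := Finset.univ.powersetCard 3
  have hsub : {x ∈ K ×ˢ K | ¬ Disjoint (cliqueOn x.1).edgeSet (cliqueOn x.2).edgeSet} ⊆
      K.diag ∪ sharingPairs V := fun x hx => by
    simp only [K, edgeSet_cliqueOn, Finset.mem_filter, Finset.mem_product,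
      Finset.mem_powersetCard_univ] at hx
    rw [Finset.mem_union, Finset.mem_diag, mem_sharingPairs, Finset.mem_powersetCard_univ]
    tauto
  have hdisj : Disjoint K.diag (sharingPairs V) := Finset.disjoint_left.2 fun x hx hx' =>
    (mem_sharingPairs.1 hx').2.2.1 (Finset.mem_diag.1 hx).2
  have hdiag : ∑ x ∈ K.diag, (p : ℝ) ^ (cliqueOn x.1 ⊔ cliqueOn x.2).edgeSet.ncard =
      expTriangles V p := by
    rw [Finset.sum_diag, Finset.sum_congr rfl fun t ht => by
      rw [sup_idem, ncard_edgeSet_cliqueOn, (Finset.mem_powersetCard.1 ht).2]]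
    simp [K, expTriangles]
  simp_rw [card_triangles]
  calc Var[fun G => (subgraphCount K cliqueOn G : ℝ); G(V, p)]
      ≤ ∑ x ∈ K ×ˢ K with ¬ Disjoint (cliqueOn x.1).edgeSet (cliqueOn x.2).edgeSet,
          (p : ℝ) ^ (cliqueOn x.1 ⊔ cliqueOn x.2).edgeSet.ncard := by
        convert variance_subgraphCount_le p K cliqueOn
    _ ≤ ∑ x ∈ K.diag ∪ sharingPairs V,
          (p : ℝ) ^ (cliqueOn x.1 ⊔ cliqueOn x.2).edgeSet.ncard :=
        Finset.sum_le_sum_of_subset_of_nonneg hsub fun _ _ _ => by positivity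
    _ = expTriangles V p + ∫ G : SimpleGraph V, (sharingCount G : ℝ) ∂G(V, p) := by
        rw [Finset.sum_union hdisj, hdiag]
        unfold sharingCount
        rw [integral_subgraphCount]

end SharingPairs

section LowerTail

variable [Fintype V] {p : unitInterval}

theorem measureReal_nu_lt_le (hμ : 0 < expTriangles V p) :
    G(V, p).real {G | (nu G : ℝ) < expTriangles V p / 4} ≤
      4 * (1 + 3 * expCodegree V p) / expTriangles V p + 12 * expCodegree V p := by
  set μ := expTriangles V p
  set d := expCodegree V p
  have hd : 0 ≤ d := expCodegree_nonneg p
  have hsharing : ∫ G : SimpleGraph V, (sharingCount G : ℝ) ∂G(V, p) ≤ 3 * d * μ :=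
    integral_sharingCount_le p
  have hchebyshev : G(V, p).real {G | μ / 2 ≤ |(#(triangles G) : ℝ) - μ|} ≤
      4 * (1 + 3 * d) / μ := by
    refine ENNReal.toReal_le_of_le_ofReal (by positivity) ?_
    have hvariance := variance_card_triangles_le (V := V) p
    have := meas_ge_le_variance_div_sq (μ := G(V, p))
      (X := fun G : SimpleGraph V => (#(triangles G) : ℝ)) .of_discrete (half_pos hμ)
    rw [integral_card_triangles] at this
    refine this.trans (ENNReal.ofReal_le_ofReal ?_)
    calc Var[fun G : SimpleGraph V => (#(triangles G) : ℝ); G(V, p)] / (μ / 2) ^ 2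
        ≤ (μ + 3 * d * μ) / (μ / 2) ^ 2 := by gcongr; linarith
      _ = 4 * (1 + 3 * d) / μ := by field_simp; ring
  have hmarkov : G(V, p).real {G | μ / 4 ≤ sharingCount G} ≤ 12 * d := by
    have := mul_meas_ge_le_integral_of_nonneg (μ := G(V, p))
      (f := fun G : SimpleGraph V => (sharingCount G : ℝ)) (.of_forall fun _ => by positivity)
      .of_finite (μ / 4)
    nlinarith
  have hsub : {G : SimpleGraph V | (nu G : ℝ) < μ / 4} ⊆
      {G | μ / 2 ≤ |(#(triangles G) : ℝ) - μ|} ∪ {G | μ / 4 ≤ sharingCount G} := by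
    intro G hG
    by_contra! hnot
    simp only [Set.mem_union, Set.mem_ofPred_eq, not_or, not_le, abs_lt] at hG hnot
    have : (#(triangles G) : ℝ) ≤ nu G + sharingCount G :=
      mod_cast card_triangles_le_nu_add_sharingCount G
    linarith
  exact (measureReal_mono hsub).trans ((measureReal_union_le _ _).trans (by gcongr))

theorem measureReal_nu_lt_le_of_thinning (hd : expCodegree V p ≤ 1 / 2)
    (hμ : 0 < expTriangles V p) {θ : unitInterval} (hθ : 0 < θ) :
    G(V, p).real {G | (nu G : ℝ) < (θ : ℝ) ^ 3 * expTriangles V p / 4} ≤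
      10 / ((θ : ℝ) ^ 3 * expTriangles V p) + 6 * (θ : ℝ) ^ 2 := by
  have hθ₀ : (0 : ℝ) < θ := hθ
  have hθ₁ : (θ : ℝ) ^ 2 ≤ 1 := pow_le_one₀ hθ₀.le θ.2.2
  have hcodegree : expCodegree V (θ * p) ≤ (θ : ℝ) ^ 2 / 2 := by
    rw [expCodegree_mul]
    nlinarith [sq_nonneg (θ : ℝ)]
  have hμθ : 0 < expTriangles V (θ * p) := by
    rw [expTriangles_mul]
    positivity
  have hlower : IsLowerSet {G : SimpleGraph V | (nu G : ℝ) < expTriangles V (θ * p) / 4} :=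
    fun _ _ h hG => by
      rw [Set.mem_ofPred_eq] at hG ⊢
      exact (Nat.cast_le.2 (nu_mono h)).trans_lt hG
  rw [← expTriangles_mul]
  calc G(V, p).real {G | (nu G : ℝ) < expTriangles V (θ * p) / 4}
      ≤ G(V, θ * p).real {G | (nu G : ℝ) < expTriangles V (θ * p) / 4} :=
        binomialRandom_real_le_mul hlower θ p
    _ ≤ 4 * (1 + 3 * expCodegree V (θ * p)) / expTriangles V (θ * p) +
          12 * expCodegree V (θ * p) := measureReal_nu_lt_le hμθ
    _ ≤ 10 / expTriangles V (θ * p) + 6 * (θ : ℝ) ^ 2 := by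
        exact add_le_add (div_le_div_of_nonneg_right (by linarith) hμθ.le) (by linarith)

end LowerTail

section Deviation

variable [Fintype V] {p : unitInterval}

theorem mul_measureReal_le_tau_sub_nu_le (a : ℝ) :
    a * G(V, p).real {G | a ≤ (tau G : ℝ) - nu G} ≤
      ∫ G : SimpleGraph V, ((tau G : ℝ) - nu G) ∂G(V, p) :=
  mul_meas_ge_le_integral_of_nonneg
    (.of_forall fun G => sub_nonneg.2 (Nat.cast_le.2 (nu_le_tau G))) .of_finite a

theorem measureReal_tau_ne_nu_le :
    G(V, p).real {G | tau G ≠ nu G} ≤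
      ∫ G : SimpleGraph V, ((tau G : ℝ) - nu G) ∂G(V, p) := by
  have hset : {G : SimpleGraph V | tau G ≠ nu G} = {G | 1 ≤ (tau G : ℝ) - nu G} := by
    ext G
    have hle := nu_le_tau G
    rw [Set.mem_ofPred_eq, Set.mem_ofPred_eq, le_sub_iff_add_le]
    norm_cast
    lia
  simpa [hset] using mul_measureReal_le_tau_sub_nu_le (V := V) (p := p) 1

theorem measureReal_mul_nu_lt_tau_sub_nu_le_add {ε : ℝ} (hε : 0 < ε) {a : ℝ} (ha : 0 < a) :
    G(V, p).real {G | ε * nu G < (tau G : ℝ) - nu G} ≤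
      G(V, p).real {G | (nu G : ℝ) < a} +
        (∫ G : SimpleGraph V, ((tau G : ℝ) - nu G) ∂G(V, p)) / (ε * a) := by
  have hsub : {G : SimpleGraph V | ε * nu G < (tau G : ℝ) - nu G} ⊆
      {G | (nu G : ℝ) < a} ∪ {G | ε * a ≤ (tau G : ℝ) - nu G} := fun G hG => by
    by_contra! hnot
    simp only [Set.mem_union, Set.mem_ofPred_eq, not_or, not_le, not_lt] at hG hnot
    nlinarith
  refine (measureReal_mono hsub).trans ((measureReal_union_le _ _).trans ?_)
  gcongr
  rw [le_div_iff₀' (by positivity)]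
  exact mul_measureReal_le_tau_sub_nu_le _

-- With few expected triangles `τ = ν` is likely; with more than `x⁻⁴`, `ν` is likely to be at
-- least a constant multiple of `x³` times their number. Thinning by `1 - x⁵` balances the errors.
theorem measureReal_mul_nu_lt_tau_sub_nu_le (hd : expCodegree V p ≤ 1 / 2) {x : unitInterval}
    (hx : 0 < x) (hpx : p ≤ x ^ 15) {ε : ℝ} (hε : 0 < ε) :
    G(V, p).real {G | ε * nu G < (tau G : ℝ) - nu G} ≤ (16 + 36 / ε) * x := by
  have hx₀ : (0 : ℝ) < x := hx
  have hx₁ : (x : ℝ) ≤ 1 := x.2.2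
  set μ := expTriangles V p
  have hgap : ∫ G : SimpleGraph V, ((tau G : ℝ) - nu G) ∂G(V, p) ≤ 9 * (x : ℝ) ^ 5 * μ := by
    simpa using integral_tau_sub_nu_le_of_le_pow p hd (pow_pos hx 5) (by rwa [← pow_mul])
  obtain hfew | hmany := le_or_gt ((x : ℝ) ^ 4 * μ) 1
  · have hsub : {G : SimpleGraph V | ε * nu G < (tau G : ℝ) - nu G} ⊆ {G | tau G ≠ nu G} :=
      fun G hG heq => by
        have : ε * (nu G : ℝ) < 0 := by simpa [heq] using hG
        exact this.not_ge (by positivity)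
    have : 0 ≤ 36 / ε * (x : ℝ) := by positivity
    calc G(V, p).real {G | ε * nu G < (tau G : ℝ) - nu G}
        ≤ 9 * (x : ℝ) ^ 5 * μ :=
          (measureReal_mono hsub).trans (measureReal_tau_ne_nu_le.trans hgap)
      _ = 9 * x * ((x : ℝ) ^ 4 * μ) := by ring
      _ ≤ 9 * x * 1 := by gcongr
      _ ≤ (16 + 36 / ε) * x := by linarith
  · have hμ₀ : 0 < μ := pos_of_mul_pos_right (one_pos.trans hmany) (by positivity)
    calc G(V, p).real {G | ε * nu G < (tau G : ℝ) - nu G}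
        ≤ (10 / ((x : ℝ) ^ 3 * μ) + 6 * (x : ℝ) ^ 2) +
            9 * (x : ℝ) ^ 5 * μ / (ε * ((x : ℝ) ^ 3 * μ / 4)) := by
          refine (measureReal_mul_nu_lt_tau_sub_nu_le_add hε
            (a := (x : ℝ) ^ 3 * μ / 4) (by positivity)).trans ?_
          gcongr
          exact measureReal_nu_lt_le_of_thinning hd hμ₀ hx
      _ = 10 * x / ((x : ℝ) ^ 4 * μ) + 6 * (x : ℝ) ^ 2 + 36 / ε * (x : ℝ) ^ 2 := by
          field_simp
          ring
      _ ≤ 10 * x / 1 + 6 * x + 36 / ε * x := by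
          have : (x : ℝ) ^ 2 ≤ x := pow_le_of_le_one hx₀.le hx₁ two_ne_zero
          gcongr
      _ = (16 + 36 / ε) * x := by ring

theorem tendsto_nhds_zero_of_sub_two_mul_sq_le {u : ℕ → ℝ} {C : ℝ}
    (h : ∀ᶠ n : ℕ in atTop, ((n : ℝ) - 2) * u n ^ 2 ≤ C) : Tendsto u atTop (𝓝 0) := by
  have hnat : Tendsto (fun n : ℕ => (n : ℝ) - 2) atTop atTop :=
    tendsto_atTop_add_const_right _ _ tendsto_natCast_atTop_atTop
  have hsq : Tendsto (fun n => u n ^ 2) atTop (𝓝 0) := by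
    refine squeeze_zero' (.of_forall fun n => sq_nonneg _) ?_ (hnat.const_div_atTop C)
    filter_upwards [h, hnat.eventually_gt_atTop 0] with n hn hpos
    rwa [le_div_iff₀' hpos]
  have habs := hsq.sqrt
  simp_rw [Real.sqrt_sq_eq_abs, Real.sqrt_zero] at habs
  exact (tendsto_zero_iff_abs_tendsto_zero u).2 habs

theorem tendsto_measureReal_mul_nu_lt_tau_sub_nu {p : ℕ → unitInterval}
    (hd : ∀ᶠ n : ℕ in atTop, ((n : ℝ) - 2) * (p n : ℝ) ^ 2 ≤ 1 / 2) {ε : ℝ} (hε : 0 < ε) :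
    Tendsto (fun n => G(Fin n, p n).real {G | ε * nu G < (tau G : ℝ) - nu G}) atTop (𝓝 0) := by
  have hp : Tendsto (fun n => (p n : ℝ)) atTop (𝓝 0) := tendsto_nhds_zero_of_sub_two_mul_sq_le hd
  refine tendsto_order.2 ⟨fun a ha => .of_forall fun n => ha.trans_le measureReal_nonneg,
    fun η hη => ?_⟩
  obtain ⟨x, hx₀, hx⟩ := exists_between (lt_min one_pos (show 0 < η / (16 + 36 / ε) by positivity))
  obtain ⟨hx₁, hxη⟩ := lt_min_iff.1 hx
  filter_upwards [hd, hp.eventually_lt_const (pow_pos hx₀ 15), eventually_ge_atTop 2]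
    with n hdn hpn hn
  have hcodegree : expCodegree (Fin n) (p n) ≤ 1 / 2 := by
    simpa [expCodegree, Nat.cast_sub hn] using hdn
  calc G(Fin n, p n).real {G | ε * nu G < (tau G : ℝ) - nu G} ≤ (16 + 36 / ε) * x :=
        measureReal_mul_nu_lt_tau_sub_nu_le hcodegree (x := ⟨x, hx₀.le, hx₁.le⟩) hx₀ hpn.le hε
    _ < η := (lt_div_iff₀' (by positivity)).1 hxη

end Deviation

end TriangleTuza

theorem mainTheorem2 (p : ℕ → unitInterval)
    (hd : ∀ᶠ n : ℕ in atTop, ((n : ℝ) - 2) * (p n : ℝ) ^ 2 ≤ 1 / 2) :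
    ∀ ε : ℝ, 0 < ε →
      Tendsto
        (fun n : ℕ => SimpleGraph.binomialRandom (Fin n) (p n)
          {G : SimpleGraph (Fin n) |
            |(TriangleTuza.tau G : ℝ) - (TriangleTuza.nu G : ℝ)| ≤
              ε * (TriangleTuza.nu G : ℝ)})
        atTop (𝓝 1) := by
  intro ε hε
  have hgap (n : ℕ) (G : SimpleGraph (Fin n)) :
      0 ≤ (TriangleTuza.tau G : ℝ) - TriangleTuza.nu G :=
    sub_nonneg.2 (Nat.cast_le.2 (TriangleTuza.nu_le_tau G))
  have hcompl (n : ℕ) : {G : SimpleGraph (Fin n) |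
      |(TriangleTuza.tau G : ℝ) - TriangleTuza.nu G| ≤ ε * TriangleTuza.nu G} =
      {G | ε * TriangleTuza.nu G < (TriangleTuza.tau G : ℝ) - TriangleTuza.nu G}ᶜ := by
    ext G
    simp [abs_of_nonneg (hgap n G)]
  have hreal := (TriangleTuza.tendsto_measureReal_mul_nu_lt_tau_sub_nu hd hε).const_sub 1
  have hprob := ENNReal.tendsto_ofReal hreal
  rw [sub_zero, ENNReal.ofReal_one] at hprob
  refine hprob.congr fun n => ?_
  rw [hcompl, ← probReal_compl_eq_one_sub .of_discrete, ofReal_measureReal]
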